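/- Let $H$ be a complex Hilbert space and let $\mathbb{B}(H)$ be the algebra of bounded linear operators on $H$. For $S\in\mathbb{B}(H)$ let $\|S\|$ be the operator norm, $|S|=(S^*S)^{1/2}$, and let $w(S)=\sup\{|\langle Sx,x\rangle| : x\in H,\ \|x\|=1\}$ be the numerical radius (with $w(S)=0$ if $H=\{0\}$). Let $T\in\mathbb{B}(H)$ and $0\le t\le 1$, and put $$Q_t=|T^*|^{2(1-t)}+|T|^{2t},$$ where powers of positive operators are defined by the continuous functional calculus, with $A^0=I$. Then $$w(T)\le\sqrt{\tfrac1{16}\|Q_t\|^2+\tfrac14 w(T)^2+\tfrac18 w(TQ_t+Q_tT)}\le\tfrac14\|Q_t\|+\tfrac12 w(T)\le\tfrac12\|Q_t\|.$$ -/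

import Mathlib

/-- The numerical radius `w(T) = sup {|⟨T x, x⟩| : ‖x‖ = 1}` of a bounded operator. -/
noncomputable def numericalRadius {H : Type*} [NormedAddCommGroup H] [InnerProductSpace ℂ H]
    (T : H →L[ℂ] H) : ℝ :=
  sSup {r : ℝ | ∃ x : H, ‖x‖ = 1 ∧ r = ‖inner ℂ (T x) x‖}

/-- The set in the definition of the numerical radius is bounded above, so that the real
supremum is a genuine one whenever the space is nontrivial. -/
theorem numericalRadius_bddAbove {H : Type*} [NormedAddCommGroup H] [InnerProductSpace ℂ H]
    (T : H →L[ℂ] H) : BddAbove {r : ℝ | ∃ x : H, ‖x‖ = 1 ∧ r = ‖inner ℂ (T x) x‖} := by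
  refine ⟨‖T‖, ?_⟩
  rintro r ⟨x, hx, rfl⟩
  calc ‖inner ℂ (T x) x‖ ≤ ‖T x‖ * ‖x‖ := norm_inner_le_norm _ _
    _ ≤ ‖T‖ := by simpa [hx] using T.le_opNorm x

/-- `Q_t = |T*| ^ (2 (1 - t)) + |T| ^ (2 t)`. Here `CFC.abs S = (S* S) ^ (1/2)`, and the real powers
are those of the continuous functional calculus for positive operators, with `A ^ 0 = 1`. -/
noncomputable def operatorQ {H : Type*} [NormedAddCommGroup H] [InnerProductSpace ℂ H]
    [CompleteSpace H] (T : H →L[ℂ] H) (t : ℝ) : H →L[ℂ] H :=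
  CFC.rpow (CFC.abs (ContinuousLinearMap.adjoint T)) (2 * (1 - t)) + CFC.rpow (CFC.abs T) (2 * t)

/-! Beyond selfadjointness, `Q = operatorQ T t` enters only through the mixed Schwarz bound
2|⟨Tx,x⟩| ≤ ⟨Qx,x⟩ (`two_mul_norm_inner_le_re_inner_operatorQ`). Given a unit vector x, rotate T by
a phase making ⟨Tx,x⟩ nonnegative, and let R be the real part of the rotated operator. Then
4|⟨Tx,x⟩| ≤ ⟨(2R+Q)x,x⟩ ≤ ‖2Rx+Qx‖; squaring gives the radicand, since ‖R‖ ≤ w(T) and the cross term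
is controlled by w(TQ+QT). The second inequality is w(TQ+QT) ≤ 2‖Q‖w(T), which completes a square;
the third is w(T) ≤ ‖Q‖/2, again from mixed Schwarz. -/

section NumericalRadius

variable {H : Type*} [NormedAddCommGroup H] [InnerProductSpace ℂ H]

theorem numericalRadius_nonneg (T : H →L[ℂ] H) : 0 ≤ numericalRadius T :=
  Real.sSup_nonneg (by rintro r ⟨x, -, rfl⟩; exact norm_nonneg _)

theorem numericalRadius_le {T : H →L[ℂ] H} {c : ℝ} (hc : 0 ≤ c)
    (h : ∀ x : H, ‖x‖ = 1 → ‖inner ℂ (T x) x‖ ≤ c) : numericalRadius T ≤ c :=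
  Real.sSup_le (by rintro r ⟨x, hx, rfl⟩; exact h x hx) hc

theorem norm_inner_le_numericalRadius (T : H →L[ℂ] H) {x : H} (hx : ‖x‖ = 1) :
    ‖inner ℂ (T x) x‖ ≤ numericalRadius T :=
  le_csSup (numericalRadius_bddAbove T) ⟨x, hx, rfl⟩

theorem norm_inner_le_numericalRadius_mul_sq (T : H →L[ℂ] H) (x : H) :
    ‖inner ℂ (T x) x‖ ≤ numericalRadius T * ‖x‖ ^ 2 := by
  rcases eq_or_ne x 0 with rfl | hx
  · simp
  have hx' : 0 < ‖x‖ := norm_pos_iff.mpr hx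
  have h := norm_inner_le_numericalRadius T (x := ((‖x‖⁻¹ : ℝ) : ℂ) • x)
    (by rw [norm_smul]; simp [hx'.ne'])
  rw [map_smul, inner_smul_left, inner_smul_right, norm_mul, norm_mul] at h
  simp only [Complex.conj_ofReal, Complex.norm_real, norm_inv, norm_norm] at h
  rw [← mul_assoc, ← mul_inv, inv_mul_le_iff₀ (by positivity)] at h
  linarith

theorem numericalRadius_smul_le (T : H →L[ℂ] H) {c : ℂ} (hc : ‖c‖ = 1) :
    numericalRadius (c • T) ≤ numericalRadius T := by
  refine numericalRadius_le (numericalRadius_nonneg T) fun x hx => ?_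
  simpa [inner_smul_left, hc] using norm_inner_le_numericalRadius T hx

theorem exists_rotation_re_inner_eq_norm (T : H →L[ℂ] H) (x : H) :
    ∃ c : ℂ, ‖c‖ = 1 ∧ (inner ℂ ((c • T) x) x).re = ‖inner ℂ (T x) x‖ := by
  obtain ⟨c, hc, h⟩ : ∃ c : ℂ, ‖c‖ = 1 ∧ ((‖inner ℂ (T x) x‖ : ℝ) : ℂ) = c * inner ℂ (T x) x :=
    RCLike.exists_norm_eq_mul_self (inner ℂ (T x) x)
  refine ⟨star c, by simpa using hc, ?_⟩
  have : inner ℂ ((star c • T) x) x = c * inner ℂ (T x) x := by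
    simp [mul_comm]
  rw [this, ← h, Complex.ofReal_re]

theorem smul_mul_add_mul_smul (c : ℂ) (T Q : H →L[ℂ] H) :
    (c • T) * Q + Q * (c • T) = c • (T * Q + Q * T) := by
  rw [smul_mul_assoc, mul_smul_comm, smul_add]

theorem re_inner_le_re_inner_of_le {A B : H →L[ℂ] H} (h : A ≤ B) (x : H) :
    (inner ℂ (A x) x).re ≤ (inner ℂ (B x) x).re := by
  have := ((ContinuousLinearMap.le_def A B).mp h).re_inner_nonneg_left x
  simpa [inner_sub_left] using this

variable [CompleteSpace H]

/-- The real part `(T + T*) / 2` of a bounded operator. -/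
noncomputable def reOperator (T : H →L[ℂ] H) : H →L[ℂ] H :=
  (2⁻¹ : ℂ) • (T + ContinuousLinearMap.adjoint T)

theorem re_inner_reOperator_left (T : H →L[ℂ] H) (x y : H) :
    (inner ℂ (reOperator T x) y).re =
      ((inner ℂ (T x) y).re + (inner ℂ (T y) x).re) / 2 := by
  have h : (inner ℂ (ContinuousLinearMap.adjoint T x) y).re = (inner ℂ (T y) x).re := by
    rw [ContinuousLinearMap.adjoint_inner_left]
    exact inner_re_symm (𝕜 := ℂ) _ _
  have h2 : (starRingEnd ℂ) (2⁻¹ : ℂ) = ((2⁻¹ : ℝ) : ℂ) := by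
    rw [← Complex.conj_ofReal, Complex.ofReal_inv, Complex.ofReal_ofNat]
  simp only [reOperator, smul_apply, add_apply,
    inner_smul_left, inner_add_left, h2, Complex.re_ofReal_mul, Complex.add_re, h]
  ring

theorem isSelfAdjoint_reOperator (T : H →L[ℂ] H) : IsSelfAdjoint (reOperator T) := by
  have h2 : IsSelfAdjoint (2⁻¹ : ℂ) := by
    rw [isSelfAdjoint_iff, star_inv₀, star_ofNat]
  exact h2.smul (IsSelfAdjoint.add_star_self T)

/-- A selfadjoint operator has norm equal to the supremum of its absolute Rayleigh quotients, here
|Re⟨Tx,x⟩|/‖x‖². -/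
theorem norm_reOperator_le (T : H →L[ℂ] H) : ‖reOperator T‖ ≤ numericalRadius T := by
  rw [ContinuousLinearMap.norm_eq_iSup_rayleighQuotient _ (isSelfAdjoint_reOperator T).isSymmetric]
  refine ciSup_le fun x => ?_
  rcases eq_or_ne x 0 with rfl | hx
  · simpa [ContinuousLinearMap.rayleighQuotient] using numericalRadius_nonneg T
  rw [ContinuousLinearMap.rayleighQuotient, abs_div, abs_sq,
    div_le_iff₀ (by have := norm_pos_iff.mpr hx; positivity),
    ContinuousLinearMap.reApplyInnerSelf_apply]
  have h := re_inner_reOperator_left T x x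
  rw [add_self_div_two] at h
  exact (congrArg abs h).trans_le
    ((Complex.abs_re_le_norm _).trans (norm_inner_le_numericalRadius_mul_sq T x))

theorem re_inner_mul_add_mul {Q : H →L[ℂ] H} (hQ : IsSelfAdjoint Q) (T : H →L[ℂ] H) (x : H) :
    (inner ℂ ((T * Q + Q * T) x) x).re = 2 * (inner ℂ (reOperator T x) (Q x)).re := by
  have h : inner ℂ (Q (T x)) x = inner ℂ (T x) (Q x) := hQ.isSymmetric (T x) x
  rw [re_inner_reOperator_left]
  simp only [add_apply, mul_apply_eq_comp, inner_add_left,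
    Complex.add_re, h]
  ring

/-- After a rotation only the real part of T is paired with Qx, and w(T) bounds its norm; going
through ‖T‖ ≤ 2w(T) would cost another factor 2. -/
theorem numericalRadius_mul_add_mul_le {Q : H →L[ℂ] H} (hQ : IsSelfAdjoint Q) (T : H →L[ℂ] H) :
    numericalRadius (T * Q + Q * T) ≤ 2 * (‖Q‖ * numericalRadius T) := by
  have hw := numericalRadius_nonneg T
  refine numericalRadius_le (by positivity) fun x hx => ?_
  obtain ⟨c, hc, h⟩ := exists_rotation_re_inner_eq_norm (T * Q + Q * T) x
  rw [← h, ← smul_mul_add_mul_smul, re_inner_mul_add_mul hQ]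
  have h1 : (inner ℂ (reOperator (c • T) x) (Q x)).re ≤
      ‖reOperator (c • T) x‖ * ‖Q x‖ := re_inner_le_norm (𝕜 := ℂ) _ _
  have h2 : ‖reOperator (c • T) x‖ ≤ numericalRadius T := by
    have := (reOperator (c • T)).le_opNorm x
    rw [hx, mul_one] at this
    exact this.trans ((norm_reOperator_le _).trans (numericalRadius_smul_le T hc))
  have h3 : ‖Q x‖ ≤ ‖Q‖ := by simpa [hx] using Q.le_opNorm x
  have h4 := mul_le_mul h2 h3 (norm_nonneg _) hw
  linarith

theorem numericalRadius_le_sqrt {Q : H →L[ℂ] H} (hQ : IsSelfAdjoint Q) {T : H →L[ℂ] H}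
    (hT : ∀ x, 2 * ‖inner ℂ (T x) x‖ ≤ (inner ℂ (Q x) x).re) :
    numericalRadius T ≤ Real.sqrt ((1 / 16) * ‖Q‖ ^ 2 + (1 / 4) * numericalRadius T ^ 2
          + (1 / 8) * numericalRadius (T * Q + Q * T)) := by
  refine numericalRadius_le (Real.sqrt_nonneg _) fun x hx => Real.le_sqrt_of_sq_le ?_
  obtain ⟨c, hc, h⟩ := exists_rotation_re_inner_eq_norm T x
  set R := reOperator (c • T) with hR
  have hRx : ‖R x‖ ≤ numericalRadius T := by
    have := R.le_opNorm x
    rw [hx, mul_one] at this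
    exact this.trans ((norm_reOperator_le _).trans (numericalRadius_smul_le T hc))
  have hQx : ‖Q x‖ ≤ ‖Q‖ := by simpa [hx] using Q.le_opNorm x
  have hRQ : 2 * (inner ℂ (R x) (Q x)).re ≤ numericalRadius (T * Q + Q * T) := by
    rw [hR, ← re_inner_mul_add_mul hQ, smul_mul_add_mul_smul]
    exact (Complex.re_le_norm _).trans
      ((norm_inner_le_numericalRadius _ hx).trans (numericalRadius_smul_le _ hc))
  have hre : (inner ℂ (R x) x).re = ‖inner ℂ (T x) x‖ := by
    rw [hR, re_inner_reOperator_left, add_self_div_two, h]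
  have hle : 4 * ‖inner ℂ (T x) x‖ ≤ ‖(2 : ℂ) • R x + Q x‖ := by
    have h1 : (inner ℂ ((2 : ℂ) • R x + Q x) x).re ≤ ‖(2 : ℂ) • R x + Q x‖ * ‖x‖ :=
      re_inner_le_norm (𝕜 := ℂ) _ _
    have h2 : (inner ℂ ((2 : ℂ) • R x + Q x) x).re =
        2 * (inner ℂ (R x) x).re + (inner ℂ (Q x) x).re := by
      simp [mul_comm]
    rw [h2, hx, hre] at h1
    linarith [hT x]
  have hsq : ‖(2 : ℂ) • R x + Q x‖ ^ 2 =
      4 * ‖R x‖ ^ 2 + 4 * (inner ℂ (R x) (Q x)).re + ‖Q x‖ ^ 2 := by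
    have h1 : (inner ℂ ((2 : ℂ) • R x) (Q x)).re = 2 * (inner ℂ (R x) (Q x)).re := by
      simp [mul_comm]
    rw [norm_add_sq (𝕜 := ℂ), norm_smul, RCLike.re_eq_complex_re, h1, Complex.norm_ofNat]
    ring
  have h16 := pow_le_pow_left₀ (by positivity) hle 2
  have hR2 := pow_le_pow_left₀ (norm_nonneg _) hRx 2
  have hQ2 := pow_le_pow_left₀ (norm_nonneg _) hQx 2
  rw [hsq] at h16
  linarith

end NumericalRadius

section Intertwining

variable {A : Type*} [CStarAlgebra A]

/-- An element intertwining two selfadjoint elements intertwines their continuous functions. -/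
theorem SemiconjBy.cfc_real {x a b : A} (h : SemiconjBy x a b) (ha : IsSelfAdjoint a)
    (hb : IsSelfAdjoint b) {f : ℝ → ℝ} (hf : Continuous f) :
    SemiconjBy x (cfc f a) (cfc f b) := by
  have hpoly (p : Polynomial ℝ) : x * cfc p.eval a = cfc p.eval b * x := by
    rw [cfc_polynomial p a, cfc_polynomial p b]
    induction p using Polynomial.induction_on' with
    | add p q hp hq => simp only [map_add, mul_add, add_mul, hp, hq]
    | monomial n r =>
      rw [Polynomial.aeval_monomial, Polynomial.aeval_monomial, ← mul_assoc,
        ← Algebra.commutes, mul_assoc, (h.pow_right n).eq, mul_assoc]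
  -- One interval containing both spectra, so a single polynomial approximates `f` on each.
  set M := max (‖a‖ * ‖(1 : A)‖) (‖b‖ * ‖(1 : A)‖)
  have hspec {c : A} (hc : ‖c‖ * ‖(1 : A)‖ ≤ M) {s : ℝ} (hs : s ∈ spectrum ℝ c) :
      s ∈ Set.Icc (-M) M :=
    abs_le.mp ((spectrum.norm_le_norm_mul_of_mem hs).trans hc)
  have hnorm (ε : ℝ) (hε : 0 < ε) : ‖x * cfc f a - cfc f b * x‖ ≤ 0 + ε * (2 * ‖x‖) := by
    obtain ⟨p, hp⟩ := exists_polynomial_near_of_continuousOn (-M) M f hf.continuousOn ε hε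
    have happrox {c : A} (hsa : IsSelfAdjoint c) (hc : ‖c‖ * ‖(1 : A)‖ ≤ M) :
        ‖cfc p.eval c - cfc f c‖ ≤ ε := by
      rw [← cfc_sub p.eval f c (by fun_prop) hf.continuousOn]
      exact norm_cfc_le hε.le fun s hs => (hp s (hspec hc hs)).le
    have h1 := happrox ha (le_max_left _ _)
    have h2 := happrox hb (le_max_right _ _)
    have : x * cfc f a - cfc f b * x =
        (cfc p.eval b - cfc f b) * x - x * (cfc p.eval a - cfc f a) := by
      rw [sub_mul, mul_sub, hpoly p]; abel
    rw [this]
    calc _ ≤ ‖cfc p.eval b - cfc f b‖ * ‖x‖ + ‖x‖ * ‖cfc p.eval a - cfc f a‖ :=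
          (norm_sub_le _ _).trans (add_le_add (norm_mul_le _ _) (norm_mul_le _ _))
      _ ≤ ε * ‖x‖ + ‖x‖ * ε := by gcongr
      _ = _ := by ring
  have hzero : ‖x * cfc f a - cfc f b * x‖ ≤ 0 := by
    have hlim : Filter.Tendsto (fun ε : ℝ => 0 + ε * (2 * ‖x‖)) (nhdsWithin 0 (Set.Ioi 0))
        (nhds 0) := by
      have : Continuous (fun ε : ℝ => 0 + ε * (2 * ‖x‖)) := by fun_prop
      simpa using (this.tendsto 0).mono_left nhdsWithin_le_nhds
    exact ge_of_tendsto hlim (eventually_nhdsWithin_of_forall fun ε hε => hnorm ε hε)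
  exact sub_eq_zero.mp (norm_le_zero_iff.mp hzero)

/-- Passing to functions of T*T and TT* makes the intertwining T(T*T) = (TT*)T applicable. -/
theorem CFC.abs_rpow_two_mul [PartialOrder A] [StarOrderedRing A] (a : A) {s : ℝ} (hs : 0 ≤ s) :
    CFC.rpow (CFC.abs a) (2 * s) = cfc (fun r : ℝ => r ^ s) (star a * a) := by
  rw [CFC.rpow_eq_pow, ← CFC.rpow_rpow_of_exponent_nonneg _ 2 s (by norm_num) hs,
    ← CFC.rpow_eq_cfc_real (star_mul_self_nonneg a)]
  congr 1
  have := CFC.rpow_natCast (CFC.abs a) 2 (CFC.abs_nonneg a)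
  rw [CFC.abs_sq] at this
  exact_mod_cast this

end Intertwining

section MixedSchwarz

variable {H : Type*} [NormedAddCommGroup H] [InnerProductSpace ℂ H] [CompleteSpace H]

open ContinuousLinearMap

theorem norm_apply_sq_eq_re_inner {A B : H →L[ℂ] H} (h : adjoint B * B = A) (x : H) :
    ‖B x‖ ^ 2 = (inner ℂ (A x) x).re := by
  subst h
  rw [mul_apply_eq_comp, adjoint_inner_left]
  exact (inner_self_eq_norm_sq (𝕜 := ℂ) (B x)).symm

/-- A regularised mixed Schwarz inequality. -/
theorem two_mul_norm_inner_le_add_rpow (T : H →L[ℂ] H) {t : ℝ} (ht0 : 0 < t) (ht1 : t ≤ 1)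
    {ε : ℝ} (hε : 0 < ε) (x : H) :
    2 * ‖inner ℂ (T x) x‖ ≤
      (inner ℂ (cfc (fun r : ℝ => r ^ (1 - t)) (T * adjoint T) x) x).re +
      (inner ℂ (cfc (fun r : ℝ => r ^ t) (adjoint T * T) x) x).re + ε ^ t * ‖x‖ ^ 2 := by
  set A := adjoint T * T with hA
  set B := T * adjoint T with hB
  have hA0 : 0 ≤ A := star_mul_self_nonneg T
  have hB0 : 0 ≤ B := mul_star_self_nonneg T
  have hAs : IsSelfAdjoint A := hA0.isSelfAdjoint
  have hBs : IsSelfAdjoint B := hB0.isSelfAdjoint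
  have hpos (r : ℝ) : 0 < |r| + ε := by positivity
  -- The shift by ε gives T*T negative powers even when it is not invertible; |r| makes `u s`
  -- continuous on all of ℝ.
  let u (s r : ℝ) : ℝ := (|r| + ε) ^ s
  have hu (s : ℝ) : Continuous (u s) :=
    Continuous.rpow_const (by fun_prop) fun r => Or.inl (hpos r).ne'
  have hmul (s s' : ℝ) (C : H →L[ℂ] H) : cfc (u s) C * cfc (u s') C = cfc (u (s + s')) C := by
    rw [← cfc_mul (u s) (u s') C (hu s).continuousOn (hu s').continuousOn]
    exact cfc_congr fun r _ => (Real.rpow_add (hpos r) s s').symm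
  have hadj (s : ℝ) (C : H →L[ℂ] H) : adjoint (cfc (u s) C) = cfc (u s) C :=
    (cfc_predicate (u s) C : IsSelfAdjoint _)
  have hone : cfc (u (t / 2)) A * cfc (u (-(t / 2))) A = 1 := by
    rw [hmul, add_neg_cancel]
    have : u 0 = fun _ => 1 := by ext r; exact Real.rpow_zero _
    rw [this, cfc_const_one ℝ A]
  have hsemi : SemiconjBy T (cfc (u (-t)) A) (cfc (u (-t)) B) :=
    SemiconjBy.cfc_real (by rw [SemiconjBy, hA, hB, mul_assoc]) hAs hBs (hu _)
  have hfact : inner ℂ (T x) x =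
      inner ℂ (cfc (u (t / 2)) A x) ((cfc (u (-(t / 2))) A * adjoint T) x) := by
    rw [← adjoint_inner_right, ← adjoint_inner_right, hadj, ← mul_apply_eq_comp,
      ← mul_assoc, hone, one_mul]
  have hnonneg {C : H →L[ℂ] H} (hC : 0 ≤ C) {r : ℝ} (hr : r ∈ spectrum ℝ C) : 0 ≤ r :=
    spectrum_nonneg_of_nonneg hC hr
  have hfirst : ‖cfc (u (t / 2)) A x‖ ^ 2 ≤
      (inner ℂ (cfc (fun r : ℝ => r ^ t) A x) x).re + ε ^ t * ‖x‖ ^ 2 := by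
    rw [norm_apply_sq_eq_re_inner (A := cfc (u t) A) (by rw [hadj, hmul, add_halves])]
    have hle : cfc (u t) A ≤ cfc (fun r : ℝ => r ^ t + ε ^ t) A := by
      refine cfc_mono (fun r hr => ?_) (hu t).continuousOn
        (((Real.continuous_rpow_const ht0.le).add continuous_const).continuousOn)
      have := Real.rpow_add_le_add_rpow (hnonneg hA0 hr) hε.le ht0.le ht1
      simpa only [u, abs_of_nonneg (hnonneg hA0 hr)] using this
    refine (re_inner_le_re_inner_of_le hle x).trans_eq ?_
    rw [cfc_add_const (ε ^ t) (fun r : ℝ => r ^ t) A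
      (Real.continuous_rpow_const ht0.le).continuousOn hAs, Algebra.algebraMap_eq_smul_one,
      add_apply, inner_add_left, Complex.add_re]
    congr 1
    rw [smul_apply, one_apply_eq_self, inner_smul_left_eq_smul,
      Complex.smul_re, smul_eq_mul]
    congr 1
    exact inner_self_eq_norm_sq (𝕜 := ℂ) x
  -- Intertwining turns T(A+ε)^(-t)T* into (B+ε)^(-t)B, which is at most B^(1-t).
  have hsecond : ‖(cfc (u (-(t / 2))) A * adjoint T) x‖ ^ 2 ≤
      (inner ℂ (cfc (fun r : ℝ => r ^ (1 - t)) B x) x).re := by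
    have hB' : cfc (fun r : ℝ => u (-t) r * r) B = cfc (u (-t)) B * B := by
      rw [cfc_mul (u (-t)) (fun r => r) B (hu _).continuousOn continuousOn_id, cfc_id' ℝ B]
    rw [norm_apply_sq_eq_re_inner (A := cfc (fun r : ℝ => u (-t) r * r) B)]
    · refine re_inner_le_re_inner_of_le (cfc_mono (fun r hr => ?_)
        (((hu _).mul continuous_id).continuousOn)
        (Real.continuous_rpow_const (by linarith)).continuousOn) x
      have hr0 := hnonneg hB0 hr
      change (|r| + ε) ^ (-t) * r ≤ r ^ (1 - t)
      rw [abs_of_nonneg hr0]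
      rcases hr0.eq_or_lt with rfl | hr'
      · rw [mul_zero]; exact Real.rpow_nonneg le_rfl _
      · calc (r + ε) ^ (-t) * r ≤ r ^ (-t) * r := by
              gcongr ?_ * r
              exact Real.rpow_le_rpow_of_nonpos hr' (by linarith) (by linarith)
          _ = r ^ (1 - t) := by
              rw [← Real.rpow_add_one hr'.ne']; congr 1; ring
    · have : adjoint (cfc (u (-(t / 2))) A * adjoint T) = T * cfc (u (-(t / 2))) A := by
        rw [← star_eq_adjoint, star_mul, star_eq_adjoint, star_eq_adjoint, hadj, adjoint_adjoint]
      rw [this, hB', mul_assoc, ← mul_assoc (cfc _ A) (cfc _ A), hmul, ← neg_add, add_halves,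
        ← mul_assoc, hsemi.eq, mul_assoc]
  have hcs := norm_inner_le_norm (𝕜 := ℂ) (cfc (u (t / 2)) A x)
    ((cfc (u (-(t / 2))) A * adjoint T) x)
  rw [← hfact] at hcs
  have := two_mul_le_add_sq ‖cfc (u (t / 2)) A x‖ ‖(cfc (u (-(t / 2))) A * adjoint T) x‖
  linarith

theorem two_mul_norm_inner_le_re_inner_operatorQ (T : H →L[ℂ] H) {t : ℝ} (ht0 : 0 ≤ t)
    (ht1 : t ≤ 1) (x : H) :
    2 * ‖inner ℂ (T x) x‖ ≤ (inner ℂ (operatorQ T t x) x).re := by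
  have hQ : operatorQ T t = cfc (fun r : ℝ => r ^ (1 - t)) (T * adjoint T) +
      cfc (fun r : ℝ => r ^ t) (adjoint T * T) := by
    rw [operatorQ, CFC.abs_rpow_two_mul _ (sub_nonneg.mpr ht1), CFC.abs_rpow_two_mul _ ht0]
    simp only [star_eq_adjoint, adjoint_adjoint]
  rw [hQ, add_apply, inner_add_left, Complex.add_re]
  -- At t = 0 the error ε^t‖x‖² does not vanish as ε → 0, but there Q = TT* + 1 and Cauchy–Schwarz
  -- suffices.
  rcases ht0.eq_or_lt with rfl | ht
  · have hB : IsSelfAdjoint (T * adjoint T) := IsSelfAdjoint.mul_star_self T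
    have hA : IsSelfAdjoint (adjoint T * T) := IsSelfAdjoint.star_mul_self T
    simp only [sub_zero, Real.rpow_one, Real.rpow_zero]
    rw [cfc_id' ℝ (T * adjoint T), cfc_const_one ℝ (adjoint T * T),
      ← norm_apply_sq_eq_re_inner (B := adjoint T) (by rw [adjoint_adjoint]),
      ← norm_apply_sq_eq_re_inner (B := 1) (by rw [mul_one]; exact star_one _), one_apply_eq_self,
      ← adjoint_inner_right]
    have h1 := norm_inner_le_norm (𝕜 := ℂ) x (adjoint T x)
    have h2 := two_mul_le_add_sq ‖x‖ ‖adjoint T x‖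
    linarith
  · have hlim : Filter.Tendsto (fun ε : ℝ =>
        (inner ℂ (cfc (fun r : ℝ => r ^ (1 - t)) (T * adjoint T) x) x).re +
        (inner ℂ (cfc (fun r : ℝ => r ^ t) (adjoint T * T) x) x).re + ε ^ t * ‖x‖ ^ 2)
        (nhdsWithin 0 (Set.Ioi 0))
        (nhds ((inner ℂ (cfc (fun r : ℝ => r ^ (1 - t)) (T * adjoint T) x) x).re +
        (inner ℂ (cfc (fun r : ℝ => r ^ t) (adjoint T * T) x) x).re)) := by
      have hc := (((Real.continuous_rpow_const ht.le).tendsto 0).mul_const (‖x‖ ^ 2)).const_add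
        ((inner ℂ (cfc (fun r : ℝ => r ^ (1 - t)) (T * adjoint T) x) x).re +
        (inner ℂ (cfc (fun r : ℝ => r ^ t) (adjoint T * T) x) x).re)
      rw [Real.zero_rpow ht.ne', zero_mul, add_zero] at hc
      exact hc.mono_left nhdsWithin_le_nhds
    exact ge_of_tendsto hlim (eventually_nhdsWithin_of_forall fun ε hε =>
      two_mul_norm_inner_le_add_rpow T ht ht1 hε x)

theorem isSelfAdjoint_operatorQ (T : H →L[ℂ] H) (t : ℝ) : IsSelfAdjoint (operatorQ T t) :=
  IsSelfAdjoint.add (CFC.rpow_nonneg (A := H →L[ℂ] H)).isSelfAdjoint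
    (CFC.rpow_nonneg (A := H →L[ℂ] H)).isSelfAdjoint

end MixedSchwarz

theorem corollary3p4 {H : Type*} [NormedAddCommGroup H] [InnerProductSpace ℂ H] [CompleteSpace H]
    (T : H →L[ℂ] H) (t : ℝ) (ht0 : 0 ≤ t) (ht1 : t ≤ 1) :
    numericalRadius T ≤
        Real.sqrt ((1 / 16) * ‖operatorQ T t‖ ^ 2 + (1 / 4) * numericalRadius T ^ 2
          + (1 / 8) * numericalRadius (T * operatorQ T t + operatorQ T t * T)) ∧
      Real.sqrt ((1 / 16) * ‖operatorQ T t‖ ^ 2 + (1 / 4) * numericalRadius T ^ 2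
          + (1 / 8) * numericalRadius (T * operatorQ T t + operatorQ T t * T)) ≤
        (1 / 4) * ‖operatorQ T t‖ + (1 / 2) * numericalRadius T ∧
      (1 / 4) * ‖operatorQ T t‖ + (1 / 2) * numericalRadius T ≤
        (1 / 2) * ‖operatorQ T t‖ := by
  have hQ := isSelfAdjoint_operatorQ T t
  have hT := two_mul_norm_inner_le_re_inner_operatorQ T ht0 ht1
  have hw := numericalRadius_nonneg T
  refine ⟨numericalRadius_le_sqrt hQ hT, Real.sqrt_le_iff.mpr ⟨by positivity, ?_⟩, ?_⟩
  -- The bound replaces the last term by ¼‖Q‖w(T), the cross term of (¼‖Q‖ + ½w(T))².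
  · linarith [numericalRadius_mul_add_mul_le hQ T]
  · have : numericalRadius T ≤ (1 / 2) * ‖operatorQ T t‖ := by
      refine numericalRadius_le (by positivity) fun x hx => ?_
      have h1 : (inner ℂ (operatorQ T t x) x).re ≤ ‖operatorQ T t x‖ * ‖x‖ :=
        re_inner_le_norm (𝕜 := ℂ) _ _
      have h2 := (operatorQ T t).le_opNorm x
      rw [hx, mul_one] at h1 h2
      linarith [hT x]
    linarith
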